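/- Let $X$ be a $d$-dimensional Minkowski space, i.e. a real normed space of finite dimension $d$, and let $A\subset X$ be a finite set. Let $\mathrm{FT}(A)$ denote the Fermat–Torricelli locus of $A$, the set of all points $p\in X$ that minimize $x\mapsto\sum_{a\in A}\|x-a\|$ over $X$. Then $$|A\cap \mathrm{FT}(A)|\le 2^d .$$ If $|A\cap \mathrm{FT}(A)|=2^d$, then $X$ is isometric to a $d$-dimensional $L_1$ space, with $A\cap\mathrm{FT}(A)$ corresponding to a homothet of the Hamming cube $\{0,1\}^d$. Here a $d$-dimensional $L_1$ space is a space $L_1(\mu)$, where $\mu$ is a finite measure on $\{1,\dots,d\}$ with weights $\mu_i=\mu(\{i\})>0$, that is, $\mathbf R^d$ with the norm $\|x\|=\sum_{i=1}^d\mu_i|x_i|$; precisely, there are such a $\mu$, a linear isometry $T$ of $X$ onto $L_1(\mu)$, a point $c\in L_1(\mu)$ and a number $r>0$ such that $T(A\cap\mathrm{FT}(A))=c+r\{0,1\}^d$. Equivalently, in terms of the standard space $\ell_1^d$ (all weights equal to $1$), there are a linear isometry $T$ of $X$ onto $\ell_1^d$ and $c_i\in\mathbf R$, $s_i>0$ $(1\le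 i\le d)$ such that $T(A\cap\mathrm{FT}(A))=\prod_{i=1}^d\{c_i,c_i+s_i\}$, the vertex set of an axis-parallel box. -/

import Mathlib

open MeasureTheory

/-- The Fermat-Torricelli locus of a finite set `A` of (distinct) points of a real normed space:
the set of all minimizers of `x ↦ ∑ a ∈ A, ‖x - a‖`. -/
def FT {X : Type*} [NormedAddCommGroup X] (A : Finset X) : Set X :=
  {p | ∀ x : X, ∑ a ∈ A, ‖p - a‖ ≤ ∑ a ∈ A, ‖x - a‖}

/-- `S` is a homothet of `K`: a translate of a positive multiple of `K`. -/
def IsHomothet {V : Type*} [AddCommGroup V] [Module ℝ V] (S K : Set V) : Prop :=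
  ∃ (c : V) (r : ℝ), 0 < r ∧ S = (fun v => c + r • v) '' K

/-- The Hamming cube `{0,1}^d` in the space `L_1(μ)` over a `d`-point set:
the elements of `L_1(μ)` all of whose coordinates are `0` or `1`. -/
def hammingCube {d : ℕ} (μ : Measure (Fin d)) : Set (Lp ℝ 1 μ) :=
  {f | ∀ᵐ i ∂μ, f i = 0 ∨ f i = 1}

/-! By Hahn-Banach, minimality yields functionals `φ a` in the dual unit ball that norm `p - a` for
every minimizer `p` simultaneously. For `p`, `q` among the points of `A` in the locus, `φ p - φ q`
attains its extremes over these points at `p` and `q`, so they form an antipodal set `B`. The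
Danzer-Grünbaum volume argument then gives the bound: the half-size copies of the hull at the points
of `B` lie in the hull and do not overlap.

With `2 ^ d` points the copies cover the hull
(`IsAntipodal.card_le_and_covering_of_affineSpan_eq_top`). Covering gives each face a parallel
supporting hyperplane through any point of `B` off the face (`IsAntipodal.exists_slab_of_face`), so
facet functionals, taken as extreme points of the polar, have two values on `B`. A basis of them
puts `B` inside a box with `2 ^ d` vertices, hence `B` is the box. Finally, the functional at a
vertex norms every edge there, so it computes the norm on an orthant as a weighted `ℓ₁` sum
(`norm_eq_sum_of_norming_box`). -/

/-- First-order optimality for the Fermat-Torricelli problem: a single family of norming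
functionals describes every minimizer. -/
theorem exists_norming_functionals_FT {X : Type*} [NormedAddCommGroup X] [NormedSpace ℝ X]
    (A : Finset X) :
    ∃ φ : X → StrongDual ℝ X, (∀ a ∈ A, ∀ x, φ a x ≤ ‖x‖) ∧
      ∀ p ∈ FT A, ∀ a ∈ A, φ a (p - a) = ‖p - a‖ := by
  classical
  rcases (FT A).eq_empty_or_nonempty with h0 | ⟨p₀, hp₀⟩
  · exact ⟨0, fun a _ x => by simp, by simp [h0]⟩
  let Y := PiLp 1 (fun _ : A => X)
  have hnorm : ∀ y : Y, ‖y‖ = ∑ a, ‖y a‖ := fun y => by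
    rw [PiLp.norm_eq_of_nat 1 (by norm_num)]; simp
  let diag : X →ₗ[ℝ] Y :=
    { toFun := fun x => WithLp.toLp 1 (fun _ => x)
      map_add' := fun _ _ => rfl
      map_smul' := fun _ _ => rfl }
  let D : Submodule ℝ Y := LinearMap.range diag
  let w : Y := WithLp.toLp 1 (fun a => p₀ - a)
  -- Minimality of `p₀` says that `w` has least norm in its coset modulo the diagonal, so a norming
  -- functional on the quotient norms `w` and kills the diagonal.
  have hw : ‖w‖ ≤ ‖(Submodule.Quotient.mk w : Y ⧸ D)‖ := by
    refine le_of_forall_pos_le_add fun ε hε => ?_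
    obtain ⟨m, hm, hlt⟩ := QuotientAddGroup.exists_norm_mk_lt
      (S := D.toAddSubgroup) (Submodule.Quotient.mk w : Y ⧸ D) hε
    have hm' : (Submodule.Quotient.mk m : Y ⧸ D) = Submodule.Quotient.mk w := hm
    rw [Submodule.Quotient.eq] at hm'
    obtain ⟨x, hx⟩ := hm'
    have hmw : m = w + diag x := by rw [hx]; abel
    refine le_trans ?_ hlt.le
    rw [hmw, hnorm, hnorm]
    have := hp₀ (p₀ + x)
    rw [← Finset.sum_coe_sort A, ← Finset.sum_coe_sort A] at this
    refine this.trans_eq (Finset.sum_congr rfl fun a _ => ?_)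
    change _ = ‖(p₀ - a) + x‖
    congr 1; abel
  obtain ⟨g, hg1, hgw⟩ := exists_dual_vector'' ℝ (Submodule.Quotient.mk w : Y ⧸ D)
  let F : Y →ₗ[ℝ] ℝ := g.toLinearMap ∘ₗ D.mkQ
  have hF : ∀ y, F y ≤ ‖y‖ := fun y => by
    calc F y ≤ ‖g (Submodule.Quotient.mk y : Y ⧸ D)‖ := le_abs_self _
      _ ≤ 1 * ‖(Submodule.Quotient.mk y : Y ⧸ D)‖ := g.le_of_opNorm_le hg1 _
      _ ≤ ‖y‖ := by rw [one_mul]; exact Submodule.Quotient.norm_mk_le D y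
  have hFD : ∀ x, F (diag x) = 0 := fun x => by
    have : D.mkQ (diag x) = 0 := by
      rw [Submodule.mkQ_apply, Submodule.Quotient.mk_eq_zero]; exact ⟨x, rfl⟩
    simp only [F, LinearMap.comp_apply, this, map_zero]
  have hFw : ‖w‖ ≤ F w := by
    have : F w = ‖(Submodule.Quotient.mk w : Y ⧸ D)‖ := hgw
    rw [this]; exact hw
  let inj : A → X →ₗ[ℝ] Y := fun a =>
    { toFun := fun x => WithLp.toLp 1 (Pi.single a x)
      map_add' := fun x y => by rw [Pi.single_add]; rfl
      map_smul' := fun c x => by rw [Pi.single_smul]; rfl }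
  have hinj : ∀ a x, ‖inj a x‖ = ‖x‖ := fun a x => by
    rw [hnorm, Finset.sum_eq_single a]
    · simp [inj]
    · intro b _ hb; simp [inj, hb]
    · simp
  have hdec : ∀ y : Y, y = ∑ a, inj a (y a) := fun y => by
    ext b
    rw [WithLp.ofLp_sum, Finset.sum_apply, Finset.sum_eq_single b]
    · simp [inj]
    · intro a _ ha; simp [inj, ha.symm]
    · simp
  let ψ : A → StrongDual ℝ X := fun a => (F ∘ₗ inj a).mkContinuous 1 fun x => by
    rw [one_mul, Real.norm_eq_abs, abs_le]
    constructor
    · have := hF (inj a (-x))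
      rw [hinj, norm_neg, map_neg, map_neg] at this
      change -‖x‖ ≤ F (inj a x)
      linarith
    · exact (hF _).trans_eq (hinj a x)
  have hψ : ∀ a x, ψ a x = F (inj a x) := fun a x => rfl
  have hψle : ∀ a x, ψ a x ≤ ‖x‖ := fun a x => (hF _).trans_eq (hinj a x)
  have hsum : ∀ y : Y, F y = ∑ a, ψ a (y a) := fun y => by
    conv_lhs => rw [hdec y]
    rw [map_sum]; rfl
  refine ⟨fun a => if h : a ∈ A then ψ ⟨a, h⟩ else 0, fun a ha x => by
    simp only [ha, dif_pos]; exact hψle _ _, fun p hp a ha => ?_⟩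
  simp only [ha, dif_pos]
  let v : Y := WithLp.toLp 1 (fun a => p - a)
  have hv : ‖v‖ ≤ F v := by
    -- Minimizers differ by a diagonal vector, which `F` does not see; this is why one family serves
    -- them all.
    have h1 : v = w + diag (p - p₀) := by
      ext b
      change p - (b : X) = (p₀ - b) + (p - p₀)
      abel
    have h2 : F v = F w := by rw [h1, map_add, hFD, add_zero]
    have h3 : ‖v‖ ≤ ‖w‖ := by
      rw [hnorm, hnorm]
      have := hp p₀
      rwa [← Finset.sum_coe_sort A, ← Finset.sum_coe_sort A] at this
    linarith
  rw [hnorm, hsum] at hv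
  have := (Finset.sum_eq_sum_iff_of_le fun b (_ : b ∈ Finset.univ) => hψle b (v b)).1
    (le_antisymm (Finset.sum_le_sum fun b _ => hψle b (v b)) hv)
  exact this ⟨a, ha⟩ (Finset.mem_univ _)

/-! ### Antipodal sets and the volume bound -/

/-- A finite set is antipodal if any two of its points lie on distinct parallel hyperplanes
bounding a slab that contains the whole set. -/
def IsAntipodal {E : Type*} [NormedAddCommGroup E] [NormedSpace ℝ E] (B : Finset E) : Prop :=
  ∀ p ∈ B, ∀ q ∈ B, p ≠ q →
    ∃ ψ : StrongDual ℝ E, ψ p < ψ q ∧ ∀ x ∈ B, ψ p ≤ ψ x ∧ ψ x ≤ ψ q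

theorem isAntipodal_of_norming {X : Type*} [NormedAddCommGroup X] [NormedSpace ℝ X]
    {B : Finset X} (φ : X → StrongDual ℝ X)
    (hφ : ∀ p ∈ B, ∀ a ∈ B, φ a (p - a) = ‖p - a‖) : IsAntipodal B := by
  intro p hp q hq hpq
  have hpos : 0 < ‖q - p‖ := norm_pos_iff.2 (sub_ne_zero.2 hpq.symm)
  have key : ∀ a ∈ B, ∀ x ∈ B, φ a x = φ a a + ‖x - a‖ := fun a ha x hx => by
    rw [← hφ x hx a ha, map_sub]; ring
  -- On `B` this functional is `‖x - p‖ - ‖x - q‖` up to a constant, so the triangle inequality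
  -- gives the slab.
  refine ⟨φ p - φ q, ?_, fun x hx => ?_⟩
  · simp only [sub_apply]
    rw [key p hp q hq, key q hq p hp, norm_sub_rev p q]; linarith
  · simp only [sub_apply]
    rw [key p hp q hq, key q hq p hp, key p hp x hx, key q hq x hx]
    have h1 := norm_sub_le_norm_sub_add_norm_sub x p q
    have h2 := norm_sub_le_norm_sub_add_norm_sub x q p
    have h3 := norm_sub_rev p q
    constructor <;> linarith

theorem convexHull_le_of_forall_le {E : Type*} [NormedAddCommGroup E] [NormedSpace ℝ E]
    {B : Set E} (g : StrongDual ℝ E) {M : ℝ} (h : ∀ x ∈ B, g x ≤ M) :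
    ∀ x ∈ convexHull ℝ B, g x ≤ M := fun _ hx =>
  convexHull_min (t := {x | g x ≤ M}) h (convex_halfSpace_le g.toLinearMap.isLinear M) hx

theorem convexHull_ge_of_forall_ge {E : Type*} [NormedAddCommGroup E] [NormedSpace ℝ E]
    {B : Set E} (g : StrongDual ℝ E) {M : ℝ} (h : ∀ x ∈ B, M ≤ g x) :
    ∀ x ∈ convexHull ℝ B, M ≤ g x := fun _ hx =>
  convexHull_min (t := {x | M ≤ g x}) h (convex_halfSpace_ge g.toLinearMap.isLinear M) hx

section Antipodal

variable {E : Type*} [NormedAddCommGroup E] [NormedSpace ℝ E]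

theorem mem_image_homothety_half {P : Set E} {b x : E} :
    x ∈ AffineMap.homothety b (1 / 2 : ℝ) '' P ↔ (2 : ℝ) • x - b ∈ P := by
  constructor
  · rintro ⟨y, hy, rfl⟩
    convert hy using 1
    rw [AffineMap.homothety_apply, vsub_eq_sub, vadd_eq_add]
    module
  · intro h
    refine ⟨_, h, ?_⟩
    rw [AffineMap.homothety_apply, vsub_eq_sub, vadd_eq_add]
    module

/-- The half-size copies of the convex hull of an antipodal set at its points do not overlap;
comparing volumes bounds the cardinality, with equality only if they cover the hull. -/
theorem IsAntipodal.card_le_and_covering_of_affineSpan_eq_top [FiniteDimensional ℝ E]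
    {B : Finset E} (hB : IsAntipodal B) (hspan : affineSpan ℝ (B : Set E) = ⊤) :
    B.card ≤ 2 ^ Module.finrank ℝ E ∧ (B.card = 2 ^ Module.finrank ℝ E →
      ∀ x ∈ convexHull ℝ (B : Set E), ∃ b ∈ B, (2 : ℝ) • x - b ∈ convexHull ℝ (B : Set E)) := by
  classical
  let _ : MeasurableSpace E := borel E
  have _ : BorelSpace E := ⟨rfl⟩
  let μ : Measure E := Measure.addHaar
  set P : Set E := convexHull ℝ (B : Set E) with hP
  have hPc : IsCompact P := B.finite_toSet.isCompact_convexHull ℝ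
  have hPconv : Convex ℝ P := convex_convexHull ℝ _
  have hint : (interior P).Nonempty := interior_convexHull_nonempty_iff_affineSpan_eq_top.2 hspan
  let T : E → Set E := fun b => AffineMap.homothety b (1 / 2 : ℝ) '' P
  have hTc : ∀ b, IsCompact (T b) := fun b =>
    hPc.image (AffineMap.homothety b (1 / 2 : ℝ)).continuous_of_finiteDimensional
  have hTP : (⋃ b ∈ B, T b) ⊆ P := by
    refine Set.iUnion₂_subset fun b hb => ?_
    rintro x hx
    have h2 := mem_image_homothety_half.1 hx
    have := hPconv h2 (subset_convexHull ℝ _ hb) (by norm_num : (0 : ℝ) ≤ 1 / 2)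
      (by norm_num : (0 : ℝ) ≤ 1 / 2) (by norm_num)
    convert this using 1
    module
  -- The slab for `p` and `q` forces the overlap of their copies into the hyperplane halfway
  -- between, which is null.
  have hdisj : Set.Pairwise (↑B) (Function.onFun (AEDisjoint μ) T) := by
    intro p hp q hq hpq
    obtain ⟨ψ, hlt, hψ⟩ := hB p hp q hq hpq
    let H : AffineSubspace ℝ E :=
      AffineSubspace.mk' ((1 / 2 : ℝ) • (p + q)) (LinearMap.ker ψ.toLinearMap)
    have hH : ∀ x, x ∈ H ↔ ψ x = (ψ p + ψ q) / 2 := fun x => by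
      rw [AffineSubspace.mem_mk', vsub_eq_sub, LinearMap.mem_ker]
      change ψ (x - (1 / 2 : ℝ) • (p + q)) = 0 ↔ _
      rw [map_sub, map_smul, map_add, smul_eq_mul, sub_eq_zero]
      constructor <;> intro h <;> linarith
    have hne : H ≠ ⊤ := fun h => by
      have : p ∈ H := h ▸ AffineSubspace.mem_top ℝ E p
      rw [hH] at this
      linarith
    refine measure_mono_null (fun x hx => ?_) (Measure.addHaar_affineSubspace μ H hne)
    have h1 := convexHull_le_of_forall_le ψ (fun x hx => (hψ x hx).2) _
      (mem_image_homothety_half.1 hx.1)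
    have h2 := convexHull_ge_of_forall_ge ψ (fun x hx => (hψ x hx).1) _
      (mem_image_homothety_half.1 hx.2)
    rw [map_sub, map_smul, smul_eq_mul] at h1 h2
    exact (hH x).2 (by linarith)
  have hvol : μ (⋃ b ∈ B, T b) =
      B.card * (ENNReal.ofReal (1 / 2) ^ Module.finrank ℝ E * μ P) := by
    rw [measure_biUnion_finset₀ hdisj fun b _ => (hTc b).measurableSet.nullMeasurableSet,
      Finset.sum_congr rfl fun b _ => Measure.addHaar_image_homothety μ b (1 / 2) P,
      Finset.sum_const, nsmul_eq_mul, abs_of_pos (by positivity),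
      ENNReal.ofReal_pow (by norm_num)]
  have hμ0 : μ P ≠ 0 := (Measure.measure_pos_of_nonempty_interior μ hint).ne'
  have hμt : μ P ≠ ⊤ := hPc.measure_lt_top.ne
  have hhalf : (2 : ENNReal) ^ Module.finrank ℝ E *
      ENNReal.ofReal (1 / 2) ^ Module.finrank ℝ E = 1 := by
    rw [← mul_pow, show (2 : ENNReal) = ENNReal.ofReal 2 by simp,
      ← ENNReal.ofReal_mul (by norm_num)]
    norm_num
  constructor
  · have hle := measure_mono (μ := μ) hTP
    rw [hvol] at hle
    have h2 : (B.card : ENNReal) * μ P ≤ (2 ^ Module.finrank ℝ E : ENNReal) * μ P := by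
      calc (B.card : ENNReal) * μ P
          = B.card * ((2 : ENNReal) ^ Module.finrank ℝ E *
              ENNReal.ofReal (1 / 2) ^ Module.finrank ℝ E) * μ P := by rw [hhalf, mul_one]
        _ = 2 ^ Module.finrank ℝ E *
              (B.card * (ENNReal.ofReal (1 / 2) ^ Module.finrank ℝ E * μ P)) := by ring
        _ ≤ _ := by gcongr
    have h3 := (ENNReal.mul_le_mul_iff_left hμ0 hμt).1 h2
    exact_mod_cast h3
  · intro hcard
    have heq : μ (⋃ b ∈ B, T b) = μ P := by
      rw [hvol, hcard, ← mul_assoc]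
      push_cast
      rw [hhalf, one_mul]
    have hUc : IsCompact (⋃ b ∈ B, T b) := B.isCompact_biUnion fun b _ => hTc b
    have hdiff : μ (P \ ⋃ b ∈ B, T b) = 0 := by
      rw [measure_sdiff hTP hUc.measurableSet.nullMeasurableSet (heq ▸ hμt), heq, tsub_self]
    -- An open null set is empty; this upgrades covering almost everywhere to covering.
    have hopen : interior P \ ⋃ b ∈ B, T b = ∅ :=
      ((isOpen_interior.sdiff hUc.isClosed).measure_eq_zero_iff μ).1
        (measure_mono_null (Set.sdiff_subset_sdiff_left interior_subset) hdiff)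
    have hcov : P ⊆ ⋃ b ∈ B, T b := by
      rw [← hPc.isClosed.closure_eq, ← hPconv.closure_interior_eq_closure_of_nonempty_interior hint]
      exact closure_minimal (Set.sdiff_eq_empty.1 hopen) hUc.isClosed
    intro x hx
    obtain ⟨b, hb, hxb⟩ := Set.mem_iUnion₂.1 (hcov hx)
    exact ⟨b, hb, mem_image_homothety_half.1 hxb⟩

/-- The volume comparison needs a hull with interior, so `B` is translated into its own direction
space. -/
theorem IsAntipodal.card_le_two_pow_finrank_span [FiniteDimensional ℝ E] {B : Finset E}
    (hB : IsAntipodal B) : B.card ≤ 2 ^ Module.finrank ℝ (vectorSpan ℝ (B : Set E)) := by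
  classical
  rcases B.eq_empty_or_nonempty with rfl | ⟨b₀, hb₀⟩
  · simp
  set V := vectorSpan ℝ (B : Set E)
  have hmem : ∀ b ∈ B, b - b₀ ∈ V := fun b hb => vsub_mem_vectorSpan ℝ hb hb₀
  let f : {b // b ∈ B} ↪ V := ⟨fun b => ⟨b - b₀, hmem b b.2⟩, fun a b h =>
    Subtype.ext (sub_left_injective (congrArg Subtype.val h))⟩
  let C : Finset V := B.attach.map f
  have hC : ∀ v : V, v ∈ C ↔ (v : E) + b₀ ∈ B := fun v => by
    simp only [C, Finset.mem_map, Finset.mem_attach, true_and]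
    constructor
    · rintro ⟨⟨b, hb⟩, rfl⟩
      change b - b₀ + b₀ ∈ B
      rwa [sub_add_cancel]
    · intro h
      exact ⟨⟨_, h⟩, Subtype.ext (add_sub_cancel_right _ _)⟩
  have hCB : C.card = B.card := by simp [C]
  have hanti : IsAntipodal C := by
    intro p hp q hq hpq
    obtain ⟨ψ, h1, h2⟩ := hB _ ((hC p).1 hp) _ ((hC q).1 hq) fun h =>
      hpq (Subtype.ext (add_right_cancel h))
    refine ⟨ψ.comp V.subtypeL, ?_, fun x hx => ?_⟩
    · simpa using h1
    · simpa using h2 _ ((hC x).1 hx)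
  have hspan : affineSpan ℝ (C : Set V) = ⊤ := by
    have h0 : (0 : V) ∈ C := (hC 0).2 (by simpa using hb₀)
    rw [AffineSubspace.affineSpan_eq_top_iff_vectorSpan_eq_top_of_nonempty ℝ V V ⟨0, h0⟩,
      vectorSpan_eq_span_vsub_set_right ℝ h0]
    apply Submodule.map_injective_of_injective V.injective_subtype
    rw [Submodule.map_span, Submodule.map_top, Submodule.range_subtype]
    change _ = vectorSpan ℝ (B : Set E)
    rw [vectorSpan_eq_span_vsub_set_right ℝ hb₀]
    congr 1
    ext x
    simp only [Set.mem_image, vsub_eq_sub, sub_zero, Finset.mem_coe]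
    constructor
    · rintro ⟨_, ⟨v, hv, rfl⟩, rfl⟩
      exact ⟨_, (hC v).1 hv, by simp⟩
    · rintro ⟨b, hb, rfl⟩
      exact ⟨_, ⟨⟨b - b₀, hmem b hb⟩, (hC _).2 (by simpa using hb), rfl⟩, rfl⟩
  rw [← hCB]
  exact (hanti.card_le_and_covering_of_affineSpan_eq_top hspan).1

theorem IsAntipodal.card_le [FiniteDimensional ℝ E] {B : Finset E} (hB : IsAntipodal B) :
    B.card ≤ 2 ^ Module.finrank ℝ E :=
  hB.card_le_two_pow_finrank_span.trans
    (Nat.pow_le_pow_right two_pos (Submodule.finrank_le _))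

/-- The bound in the dimension of the affine hull leaves no room for `2 ^ d` points in a proper
subspace. -/
theorem IsAntipodal.affineSpan_eq_top_of_card_eq [FiniteDimensional ℝ E] {B : Finset E}
    (hB : IsAntipodal B) (hcard : B.card = 2 ^ Module.finrank ℝ E) :
    affineSpan ℝ (B : Set E) = ⊤ := by
  have hne : (B : Set E).Nonempty :=
    Finset.coe_nonempty.2 (Finset.card_pos.1 (hcard ▸ by positivity))
  rw [AffineSubspace.affineSpan_eq_top_iff_vectorSpan_eq_top_of_nonempty ℝ E E hne]
  refine Submodule.eq_top_of_finrank_eq (le_antisymm (Submodule.finrank_le _) ?_)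
  have h := hB.card_le_two_pow_finrank_span
  rw [hcard] at h
  exact (Nat.pow_le_pow_iff_right one_lt_two).1 h

end Antipodal

/-! ### The equality case: facets of the hull and the box -/

section Facets

open Filter Topology

variable {E : Type*} [NormedAddCommGroup E] [NormedSpace ℝ E]

/-- If the half-size copies of the convex hull of an antipodal set `B` at its points cover the
hull, every face of the hull that misses `p ∈ B` lies in a supporting hyperplane whose parallel
through `p` is supporting as well. -/
theorem IsAntipodal.exists_slab_of_face {B : Finset E} (hB : IsAntipodal B)
    (hcov : ∀ x ∈ convexHull ℝ (B : Set E), ∃ b ∈ B,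
      (2 : ℝ) • x - b ∈ convexHull ℝ (B : Set E))
    {g : StrongDual ℝ E} {M : ℝ} (hg : ∀ x ∈ B, g x ≤ M) (hM : ∃ x ∈ B, g x = M)
    {p : E} (hp : p ∈ B) (hpM : g p < M) :
    ∃ (ψ : StrongDual ℝ E) (m : ℝ), ψ p < m ∧ (∀ x ∈ B, ψ p ≤ ψ x ∧ ψ x ≤ m) ∧
      ∀ x ∈ B, g x = M → ψ x = m := by
  classical
  set P : Set E := convexHull ℝ (B : Set E) with hP
  have hPc : IsClosed P := (B.finite_toSet.isCompact_convexHull ℝ).isClosed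
  have hPconv : Convex ℝ P := convex_convexHull ℝ _
  have hBP : ∀ x ∈ B, x ∈ P := fun x hx => subset_convexHull ℝ _ hx
  let S := B.filter fun x => g x = M
  have hSB : ∀ x ∈ S, x ∈ B := fun x hx => (Finset.mem_filter.1 hx).1
  have hS : (0 : ℝ) < S.card := by
    obtain ⟨x, hx, hxM⟩ := hM
    exact_mod_cast Finset.card_pos.2 ⟨x, Finset.mem_filter.2 ⟨hx, hxM⟩⟩
  -- The barycentre of the face has positive weight at every point of `S`, so a functional maximal
  -- at `y` is maximal on all of `S`.
  let y : E := ∑ b ∈ S, (S.card : ℝ)⁻¹ • b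
  have hsum1 : ∑ _b ∈ S, (S.card : ℝ)⁻¹ = 1 := by
    rw [Finset.sum_const, nsmul_eq_mul, mul_inv_cancel₀ hS.ne']
  have hyP : y ∈ P := hPconv.sum_mem (fun _ _ => by positivity) hsum1
    fun b hb => hBP b (hSB b hb)
  have hfy : ∀ f : StrongDual ℝ E, f y = ∑ b ∈ S, (S.card : ℝ)⁻¹ * f b := fun f => by
    simp [y, map_sum]
  have hgy : g y = M := by
    rw [hfy, Finset.sum_congr rfl fun b hb => by rw [(Finset.mem_filter.1 hb).2],
      ← Finset.sum_mul, hsum1, one_mul]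
  let U : Set E := ⋃ q ∈ B.erase p, {x | (2 : ℝ) • x - q ∈ P}
  have hU : IsClosed U := by
    refine Set.Finite.isClosed_biUnion (B.erase p).finite_toSet fun q _ => ?_
    exact hPc.preimage (by fun_prop)
  -- Just past the midpoint of `p` and `y`, the copy at `p` is left behind because `g` would exceed
  -- `M`; some other copy must cover. As these are finitely many closed sets, the midpoint itself
  -- lies in one of them.
  have hmem : ∀ t ∈ Set.Ioo (1 : ℝ) 2, p + (t / 2) • (y - p) ∈ U := by
    intro t ht
    have hxP : p + (t / 2) • (y - p) ∈ P :=
      hPconv.add_smul_sub_mem (hBP p hp) hyP ⟨by linarith [ht.1], by linarith [ht.2]⟩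
    obtain ⟨q, hq, hqP⟩ := hcov _ hxP
    refine Set.mem_iUnion₂.2 ⟨q, Finset.mem_erase.2 ⟨?_, hq⟩, hqP⟩
    rintro rfl
    have := convexHull_le_of_forall_le g hg _ hqP
    simp only [map_sub, map_smul, map_add, smul_eq_mul, hgy] at this
    nlinarith [ht.1]
  have hlim : p + ((1 : ℝ) / 2) • (y - p) ∈ U := by
    have hcont : Tendsto (fun t : ℝ => p + (t / 2) • (y - p)) (𝓝[>] 1)
        (𝓝 (p + ((1 : ℝ) / 2) • (y - p))) :=
      (Continuous.tendsto (by fun_prop) 1).mono_left nhdsWithin_le_nhds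
    exact hU.mem_of_tendsto hcont
      (eventually_of_mem (Ioo_mem_nhdsGT (by norm_num : (1 : ℝ) < 2)) hmem)
  obtain ⟨q, hq, hqP⟩ := Set.mem_iUnion₂.1 hlim
  obtain ⟨hqp, hqB⟩ := Finset.mem_erase.1 hq
  obtain ⟨ψ, hlt, hψ⟩ := hB p hp q hqB hqp.symm
  refine ⟨ψ, ψ q, hlt, hψ, fun x hx hxM => ?_⟩
  -- Here `hqP` says `p + y - q ∈ P`, and `ψ ≥ ψ p` on `P` yields `ψ q ≤ ψ y`.
  have hge := convexHull_ge_of_forall_ge ψ (fun x hx => (hψ x hx).1) _ hqP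
  simp only [map_sub, map_smul, map_add, smul_eq_mul] at hge
  have hy : ψ q ≤ ψ y := by linarith
  have hle : ∀ b ∈ S, (S.card : ℝ)⁻¹ * ψ b ≤ (S.card : ℝ)⁻¹ * ψ q := fun b hb =>
    mul_le_mul_of_nonneg_left (hψ b (hSB b hb)).2 (by positivity)
  have heq := (Finset.sum_eq_sum_iff_of_le hle).1 (le_antisymm (Finset.sum_le_sum hle) (by
    rw [← hfy, ← Finset.sum_mul, hsum1, one_mul]; exact hy)) x (Finset.mem_filter.2 ⟨hx, hxM⟩)
  exact mul_left_cancel₀ (inv_ne_zero hS.ne') heq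

/-- The polar of the finite set `B` with respect to the point `c`. -/
def polarAt (B : Finset E) (c : E) : Set (StrongDual ℝ E) := {g | ∀ b ∈ B, g (b - c) ≤ 1}

/-- An extreme point of the polar is determined by the points of `B` where it attains `1`. -/
theorem eq_zero_of_mem_extremePoints_polarAt {B : Finset E} {c : E} {g : StrongDual ℝ E}
    (hg : g ∈ (polarAt B c).extremePoints ℝ) {h : StrongDual ℝ E}
    (hh : ∀ b ∈ B, g (b - c) = 1 → h (b - c) = 0) : h = 0 := by
  have hev : ∀ᶠ ε in 𝓝 (0 : ℝ), ∀ b ∈ B, g (b - c) + ε * h (b - c) ≤ 1 := by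
    rw [Filter.eventually_all_finset]
    intro b hb
    rcases (hg.1 b hb).eq_or_lt with h1 | h1
    · simp [hh b hb h1, h1]
    · have hc : Tendsto (fun ε : ℝ => g (b - c) + ε * h (b - c)) (𝓝 0)
          (𝓝 (g (b - c) + 0 * h (b - c))) := Continuous.tendsto (by fun_prop) 0
      rw [zero_mul, add_zero] at hc
      exact (hc.eventually_lt_const h1).mono fun _ h => h.le
  obtain ⟨δ, hδ, hball⟩ := Metric.eventually_nhds_iff_ball.1 hev
  have hmem : ∀ ε : ℝ, |ε| < δ → g + ε • h ∈ polarAt B c := fun ε hε b hb => by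
    have := hball ε (by simpa using hε) b hb
    simpa using this
  have h1 := hmem (δ / 2) (by rw [abs_of_pos (by positivity)]; linarith)
  have h2 := hmem (-(δ / 2)) (by rw [abs_neg, abs_of_pos (by positivity)]; linarith)
  have hseg : g ∈ openSegment ℝ (g + (δ / 2) • h) (g + (-(δ / 2)) • h) :=
    ⟨1 / 2, 1 / 2, by norm_num, by norm_num, by norm_num, by module⟩
  have heq := hg.2 h1 h2 hseg
  rw [add_eq_left, smul_eq_zero] at heq
  exact heq.resolve_left (by positivity)

/-- Since `c` is interior, the polar is compact and Krein-Milman applies; since `B` is finite, the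
polar absorbs every functional. -/
theorem span_extremePoints_polarAt [FiniteDimensional ℝ E] {B : Finset E} {c : E}
    (hc : c ∈ interior (convexHull ℝ (B : Set E))) :
    Submodule.span ℝ ((polarAt B c).extremePoints ℝ) = ⊤ := by
  have hconv : Convex ℝ (polarAt B c) := by
    intro f hf g hg s t hs ht hst b hb
    have h1 := hf b hb
    have h2 := hg b hb
    change s * f (b - c) + t * g (b - c) ≤ 1
    nlinarith
  have hclosed : IsClosed (polarAt B c) := by
    have : polarAt B c = ⋂ b ∈ B, {g | g (b - c) ≤ 1} := by ext; simp [polarAt]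
    rw [this]
    exact isClosed_biInter fun b _ => isClosed_le (by fun_prop) continuous_const
  have hbdd : Bornology.IsBounded (polarAt B c) := by
    obtain ⟨r, hr, hball⟩ := Metric.nhds_basis_closedBall.mem_iff.1
      (mem_interior_iff_mem_nhds.1 hc)
    have hbound : ∀ g ∈ polarAt B c, ∀ z ∈ Metric.closedBall (0 : E) r, g z ≤ 1 := by
      intro g hg z hz
      have hz' : c + z ∈ convexHull ℝ (B : Set E) := hball (by simpa using hz)
      have := convexHull_le_of_forall_le g (M := 1 + g c) (fun b hb => by
        have := hg b hb
        rw [map_sub] at this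
        linarith) _ hz'
      rw [map_add] at this
      linarith
    refine isBounded_iff_forall_norm_le.2 ⟨1 / r, fun g hg => ?_⟩
    refine ContinuousLinearMap.opNorm_le_of_ball hr (by positivity) fun z _ => ?_
    refine LinearMap.bound_of_ball_bound' hr 1 g.toLinearMap (fun z hz => ?_) z
    rw [Real.norm_eq_abs, abs_le]
    have h1 := hbound g hg z hz
    have h2 := hbound g hg (-z) (by simpa using hz)
    rw [map_neg] at h2
    exact ⟨by simpa using neg_le.1 h2, h1⟩
  have hcomp : IsCompact (polarAt B c) := by
    have := FiniteDimensional.proper_real (StrongDual ℝ E)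
    exact Metric.isCompact_of_isClosed_isBounded hclosed hbdd
  have hsub : polarAt B c ⊆ Submodule.span ℝ ((polarAt B c).extremePoints ℝ) := by
    conv_lhs => rw [← closure_convexHull_extremePoints hcomp hconv]
    exact closure_minimal (convexHull_min Submodule.subset_span (Submodule.convex _))
      (Submodule.closed_of_finiteDimensional _)
  rw [eq_top_iff]
  intro f _
  have hev : ∀ᶠ ε in 𝓝 (0 : ℝ), ∀ b ∈ B, ε * f (b - c) ≤ 1 := by
    rw [Filter.eventually_all_finset]
    intro b _
    have ht : Tendsto (fun ε : ℝ => ε * f (b - c)) (𝓝 0) (𝓝 (0 * f (b - c))) :=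
      Continuous.tendsto (by fun_prop) 0
    rw [zero_mul] at ht
    exact (ht.eventually_lt_const one_pos).mono fun _ h => h.le
  obtain ⟨δ, hδ, hball⟩ := Metric.eventually_nhds_iff_ball.1 hev
  have hmem : (δ / 2) • f ∈ polarAt B c := fun b hb =>
    hball (δ / 2) (by simp [abs_of_pos hδ, hδ]) b hb
  exact (Submodule.smul_mem_iff _ (by positivity)).1 (hsub hmem)

/-- In the extremal case every extreme point of the polar takes only two values on `B`. -/
theorem IsAntipodal.exists_two_values {B : Finset E} (hB : IsAntipodal B)
    (hcov : ∀ x ∈ convexHull ℝ (B : Set E), ∃ b ∈ B,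
      (2 : ℝ) • x - b ∈ convexHull ℝ (B : Set E))
    {c : E} (hc : c ∈ convexHull ℝ (B : Set E)) {g : StrongDual ℝ E}
    (hg : g ∈ (polarAt B c).extremePoints ℝ) (hg0 : g ≠ 0) :
    ∃ m s : ℝ, 0 < s ∧ ∀ b ∈ B, g b = m ∨ g b = m + s := by
  have hle : ∀ b ∈ B, g b ≤ 1 + g c := fun b hb => by
    have := hg.1 b hb
    rw [map_sub] at this
    linarith
  have hmax : ∃ b ∈ B, g b = 1 + g c := by
    by_contra! hno
    -- With no active point the vanishing condition is vacuous, so it may be applied to `g` itself.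
    refine hg0 (eq_zero_of_mem_extremePoints_polarAt hg fun b hb h1 => ?_)
    rw [map_sub] at h1
    exact absurd (by linarith) (hno b hb)
  have hmin : ∀ p ∈ B, g p < 1 + g c → ∀ x ∈ B, g p ≤ g x := by
    intro p hp hpM x hx
    obtain ⟨ψ, m, hlt, hψ, hface⟩ := hB.exists_slab_of_face hcov hle hmax hp hpM
    -- On the active points `g (b - c) = 1` and `ψ (b - c) = m - ψ c`, so extremality makes `ψ` a
    -- multiple of `g`.
    have h0 : ψ - (m - ψ c) • g = 0 := by
      refine eq_zero_of_mem_extremePoints_polarAt hg fun b hb h1 => ?_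
      have h2 := hface b hb (by rw [map_sub] at h1; linarith)
      change ψ (b - c) - (m - ψ c) * g (b - c) = 0
      rw [h1, map_sub, h2]
      ring
    have hval : ∀ z, ψ z = (m - ψ c) * g z := fun z => by
      rw [sub_eq_zero] at h0
      conv_lhs => rw [h0]
      rfl
    have hcm : ψ c ≤ m := convexHull_le_of_forall_le ψ (fun x hx => (hψ x hx).2) c hc
    have hpos : 0 < m - ψ c := by
      refine lt_of_le_of_ne (by linarith) fun h => ?_
      have h1 := hval p
      have h2 := hval c
      rw [← h, zero_mul] at h1 h2
      linarith
    have := (hψ x hx).1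
    rw [hval p, hval x] at this
    exact le_of_mul_le_mul_left this hpos
  obtain ⟨p, hp, hpM⟩ : ∃ p ∈ B, g p < 1 + g c := by
    by_contra! hno
    have := convexHull_ge_of_forall_ge g hno c hc
    linarith
  refine ⟨g p, 1 + g c - g p, by linarith, fun b hb => ?_⟩
  rcases (hle b hb).eq_or_lt with h | h
  · right; linarith
  · left; exact le_antisymm (hmin b hb h p hp) (hmin p hp hpM b hb)

/-- The equality case of the Danzer-Grünbaum theorem: an antipodal set with `2 ^ d` points is the
vertex set of a parallelotope. -/
theorem IsAntipodal.exists_linearEquiv_box [FiniteDimensional ℝ E] {d : ℕ}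
    (hd : Module.finrank ℝ E = d) {B : Finset E} (hB : IsAntipodal B) (hcard : B.card = 2 ^ d) :
    ∃ (G : E ≃ₗ[ℝ] (Fin d → ℝ)) (m s : Fin d → ℝ), (∀ i, 0 < s i) ∧
      ∀ x, x ∈ B ↔ ∀ i, G x i = m i ∨ G x i = m i + s i := by
  classical
  rw [← hd] at hcard
  have hspan := hB.affineSpan_eq_top_of_card_eq hcard
  have hcov := (hB.card_le_and_covering_of_affineSpan_eq_top hspan).2 hcard
  rw [hd] at hcard
  obtain ⟨c, hc⟩ := interior_convexHull_nonempty_iff_affineSpan_eq_top.2 hspan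
  have hfin : Module.finrank ℝ (StrongDual ℝ E) = d := by
    rw [← LinearEquiv.finrank_eq
      (LinearMap.toContinuousLinearMap : (E →ₗ[ℝ] ℝ) ≃ₗ[ℝ] (E →L[ℝ] ℝ))]
    exact (Subspace.dual_finrank_eq (K := ℝ) (V := E)).trans hd
  have hex := Submodule.exists_fun_fin_finrank_span_eq ℝ ((polarAt B c).extremePoints ℝ)
  rw [span_extremePoints_polarAt hc, finrank_top, hfin] at hex
  obtain ⟨f, hfmem, hftop, hfli⟩ := hex
  choose m s hs hms using fun i =>
    hB.exists_two_values hcov (interior_subset hc) (hfmem i) (hfli.ne_zero i)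
  let G₀ : E →ₗ[ℝ] (Fin d → ℝ) := LinearMap.pi fun i => (f i).toLinearMap
  have hinj : Function.Injective G₀ := by
    rw [← LinearMap.ker_eq_bot, LinearMap.ker_eq_bot']
    intro x hx
    refine SeparatingDual.eq_zero_of_forall_dual_eq_zero (R := ℝ) fun g => ?_
    have hg : g ∈ Submodule.span ℝ (Set.range f) := hftop ▸ Submodule.mem_top
    induction hg using Submodule.span_induction with
    | mem g h => obtain ⟨i, rfl⟩ := h; exact congrFun hx i
    | zero => rfl
    | add g h _ _ hg hh => rw [add_apply, hg, hh, add_zero]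
    | smul r g _ hg => rw [smul_apply, hg, smul_zero]
  let G : E ≃ₗ[ℝ] (Fin d → ℝ) :=
    LinearMap.linearEquivOfInjective G₀ hinj (by simp [hd])
  have hG : ∀ x i, G x i = f i x := fun x i => rfl
  refine ⟨G, m, s, hs, fun x => ⟨fun hx i => hms i x hx, fun hx => ?_⟩⟩
  let C : Finset (Fin d → ℝ) := Fintype.piFinset fun i => {m i, m i + s i}
  have hsub : B.image G ⊆ C := by
    intro y hy
    obtain ⟨b, hb, rfl⟩ := Finset.mem_image.1 hy
    simpa [C, hG] using fun i => hms i b hb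
  have hCcard : C.card = 2 ^ d := by
    rw [Fintype.card_piFinset]
    rw [Finset.prod_congr rfl fun i _ => Finset.card_pair (by linarith [hs i])]
    simp
  have heq : B.image G = C := Finset.eq_of_subset_of_card_le hsub (by
    rw [Finset.card_image_of_injective _ G.injective, hcard, hCcard])
  have hxC : G x ∈ C := by simpa [C] using hx
  rw [← heq, Finset.mem_image] at hxC
  obtain ⟨b, hb, hbx⟩ := hxC
  exact G.injective hbx ▸ hb

end Facets

/-! ### Recovering the norm and the isometries -/

section Norm

variable {X : Type*} [NormedAddCommGroup X] [NormedSpace ℝ X] {d : ℕ}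

/-- A norm whose norming functionals at the vertices of a box are norming for the whole box is a
weighted `ℓ₁` norm in the coordinates of the box. -/
theorem norm_eq_sum_of_norming_box {B : Finset X} (φ : X → StrongDual ℝ X)
    (hle : ∀ a ∈ B, ∀ x, φ a x ≤ ‖x‖) (hφ : ∀ p ∈ B, ∀ a ∈ B, φ a (p - a) = ‖p - a‖)
    (G : X ≃ₗ[ℝ] (Fin d → ℝ)) (m s : Fin d → ℝ) (hs : ∀ i, 0 < s i)
    (hB : ∀ x, x ∈ B ↔ ∀ i, G x i = m i ∨ G x i = m i + s i) (x : X) :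
    ‖x‖ = ∑ i, ‖G.symm (Pi.single i 1)‖ * |G x i| := by
  classical
  let e : Fin d → X := fun i => G.symm (Pi.single i 1)
  have hGe : ∀ i, G (e i) = Pi.single i 1 := fun i => G.apply_symm_apply _
  have hx : x = ∑ i, G x i • e i := by
    apply G.injective
    ext j
    simp [hGe, Pi.single_apply]
  change _ = ∑ i, ‖e i‖ * |G x i|
  apply le_antisymm
  · conv_lhs => rw [hx]
    refine (norm_sum_le _ _).trans_eq (Finset.sum_congr rfl fun i _ => ?_)
    rw [norm_smul, Real.norm_eq_abs, mul_comm]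
  · let p : X := G.symm fun i => if 0 ≤ G x i then m i else m i + s i
    have hGp : ∀ i, G p i = if 0 ≤ G x i then m i else m i + s i := fun i =>
      congrFun (G.apply_symm_apply _) i
    have hp : p ∈ B := (hB p).2 fun i => by rw [hGp]; split_ifs <;> simp
    let σ : Fin d → ℝ := fun i => if 0 ≤ G x i then 1 else -1
    have hval : ∀ i, φ p (e i) * G x i = ‖e i‖ * |G x i| := by
      intro i
      have hq : p + (σ i * s i) • e i ∈ B := by
        refine (hB _).2 fun j => ?_
        rw [map_add, map_smul, Pi.add_apply, Pi.smul_apply, hGp, hGe, Pi.single_apply,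
          smul_eq_mul]
        by_cases hij : j = i
        · subst hij
          simp only [σ]
          split_ifs <;> simp
        · rw [if_neg hij, mul_zero, add_zero]
          split_ifs <;> simp
      have h1 := hφ _ hq p hp
      rw [add_sub_cancel_left, map_smul, norm_smul, Real.norm_eq_abs, abs_mul,
        abs_of_pos (hs i), smul_eq_mul] at h1
      have hsi := (hs i).ne'
      by_cases h0 : 0 ≤ G x i
      · simp only [σ, if_pos h0, abs_one, one_mul] at h1
        rw [mul_left_cancel₀ hsi h1, abs_of_nonneg h0]
      · simp only [σ, if_neg h0, abs_neg, abs_one, one_mul] at h1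
        have h2 : φ p (e i) = -‖e i‖ := mul_left_cancel₀ hsi (by linarith)
        rw [h2, abs_of_neg (not_le.1 h0)]
        ring
    calc ∑ i, ‖e i‖ * |G x i| = φ p x := by
          conv_rhs => rw [hx]
          rw [map_sum]
          refine Finset.sum_congr rfl fun i _ => ?_
          rw [map_smul, smul_eq_mul, mul_comm (G x i), hval]
      _ ≤ ‖x‖ := hle p hp x

/-- The box `∏ {m i, m i + s i}` in coordinates scaled by `w` in `ℓ₁`. -/
theorem exists_isometry_piLp_one_box {S : Set X} (G : X ≃ₗ[ℝ] (Fin d → ℝ)) (m s w : Fin d → ℝ)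
    (hs : ∀ i, 0 < s i) (hw : ∀ i, 0 < w i) (hnorm : ∀ x, ‖x‖ = ∑ i, w i * |G x i|)
    (hS : ∀ x, x ∈ S ↔ ∀ i, G x i = m i ∨ G x i = m i + s i) :
    ∃ T : X ≃ₗᵢ[ℝ] PiLp 1 (fun _ : Fin d => ℝ), ∃ (c s : Fin d → ℝ), (∀ i, 0 < s i) ∧
      T '' S = {y | ∀ i, y i = c i ∨ y i = c i + s i} := by
  let H : X ≃ₗ[ℝ] PiLp 1 (fun _ : Fin d => ℝ) :=
    (G.trans (LinearEquiv.piCongrRight fun i =>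
      LinearEquiv.smulOfNeZero ℝ ℝ (w i) (hw i).ne')).trans (WithLp.linearEquiv 1 ℝ _).symm
  have hH : ∀ x i, H x i = w i * G x i := fun x i => rfl
  let T : X ≃ₗᵢ[ℝ] PiLp 1 (fun _ : Fin d => ℝ) := ⟨H, fun x => by
    rw [PiLp.norm_eq_of_nat 1 (by norm_num), hnorm]
    simp [hH, abs_of_pos (hw _)]⟩
  refine ⟨T, fun i => w i * m i, fun i => w i * s i, fun i => mul_pos (hw i) (hs i), ?_⟩
  have hiff : ∀ x, x ∈ S ↔ ∀ i, T x i = w i * m i ∨ T x i = w i * m i + w i * s i := fun x => by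
    rw [hS]
    refine forall_congr' fun i => ?_
    change _ ↔ w i * G x i = _ ∨ w i * G x i = _
    rw [← mul_add, mul_right_inj' (hw i).ne', mul_right_inj' (hw i).ne']
  ext y
  obtain ⟨x, rfl⟩ := T.surjective y
  rw [T.injective.mem_set_image]
  exact hiff x

theorem forall_of_ae_of_singleton_pos {ι : Type*} [MeasurableSpace ι] {μ : Measure ι}
    (hμ : ∀ i, 0 < μ {i}) {q : ι → Prop} (h : ∀ᵐ i ∂μ, q i) (i : ι) : q i := by
  by_contra hi
  exact (hμ i).ne' (measure_mono_null (Set.singleton_subset_iff.2 hi) (ae_iff.1 h))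

/-- On finitely many atoms of positive finite mass, `L¹` consists of all functions. -/
theorem exists_linearEquiv_Lp_one (μ : Measure (Fin d)) [IsFiniteMeasure μ]
    (hμ : ∀ i, 0 < μ {i}) :
    ∃ J : (Fin d → ℝ) ≃ₗ[ℝ] Lp ℝ 1 μ, (∀ f i, J f i = f i) ∧
      ∀ f, ‖J f‖ = ∑ i, μ.real {i} * |f i| := by
  let J₀ : (Fin d → ℝ) →ₗ[ℝ] Lp ℝ 1 μ :=
    { toFun := fun f => (MemLp.of_discrete (f := f)).toLp f
      map_add' := fun f g => rfl
      map_smul' := fun c f => rfl }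
  have hJ : ∀ f i, J₀ f i = f i := fun f =>
    forall_of_ae_of_singleton_pos hμ (MemLp.of_discrete (f := f)).coeFn_toLp
  have hbij : Function.Bijective J₀ := by
    refine ⟨fun f g h => funext fun i => ?_, fun f => ⟨f, ?_⟩⟩
    · rw [← hJ f, h, hJ]
    · exact Lp.ext (Filter.Eventually.of_forall fun i => hJ f i)
  refine ⟨LinearEquiv.ofBijective J₀ hbij, hJ, fun f => ?_⟩
  change ‖J₀ f‖ = _
  rw [L1.norm_eq_integral_norm, integral_fintype (Integrable.of_finite)]
  simp [hJ]

/-- The box `∏ {m i, m i + s i}` as a homothet of the Hamming cube in a weighted `L¹` space. -/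
theorem exists_isometry_Lp_one_hammingCube {S : Set X} (G : X ≃ₗ[ℝ] (Fin d → ℝ))
    (m s w : Fin d → ℝ) (hs : ∀ i, 0 < s i) (hw : ∀ i, 0 < w i)
    (hnorm : ∀ x, ‖x‖ = ∑ i, w i * |G x i|)
    (hS : ∀ x, x ∈ S ↔ ∀ i, G x i = m i ∨ G x i = m i + s i) :
    ∃ μ : Measure (Fin d), IsFiniteMeasure μ ∧ (∀ i, 0 < μ {i}) ∧
      ∃ T : X ≃ₗᵢ[ℝ] Lp ℝ 1 μ, IsHomothet (T '' S) (hammingCube μ) := by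
  -- Coordinates are divided by `s i` to make the box a unit cube, so the side lengths move into the
  -- weights and the homothety ratio is `1`.
  let μ : Measure (Fin d) := ∑ i, ENNReal.ofReal (w i * s i) • Measure.dirac i
  have hμi : ∀ i, μ {i} = ENNReal.ofReal (w i * s i) := fun i => by
    simp [μ, Set.indicator_apply]
  have hpos : ∀ i, 0 < μ {i} := fun i => by
    rw [hμi, ENNReal.ofReal_pos]; exact mul_pos (hw i) (hs i)
  have hfin : IsFiniteMeasure μ := ⟨by
    simp [μ, ENNReal.sum_lt_top]⟩
  obtain ⟨J, hJ, hJn⟩ := exists_linearEquiv_Lp_one μ hpos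
  let K : X ≃ₗ[ℝ] (Fin d → ℝ) := G.trans (LinearEquiv.piCongrRight fun i =>
    LinearEquiv.smulOfNeZero ℝ ℝ (s i)⁻¹ (inv_ne_zero (hs i).ne'))
  have hK : ∀ x i, K x i = (s i)⁻¹ * G x i := fun x i => rfl
  let T : X ≃ₗᵢ[ℝ] Lp ℝ 1 μ := ⟨K.trans J, fun x => by
    rw [LinearEquiv.trans_apply, hJn, hnorm]
    refine Finset.sum_congr rfl fun i _ => ?_
    rw [hK, abs_mul, abs_of_pos (inv_pos.2 (hs i)), measureReal_def, hμi,
      ENNReal.toReal_ofReal (mul_pos (hw i) (hs i)).le]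
    have := (hs i).ne'
    field_simp⟩
  have hT : ∀ x, T x = J (K x) := fun x => rfl
  refine ⟨μ, hfin, hpos, T, J fun i => (s i)⁻¹ * m i, 1, one_pos, ?_⟩
  have hcube : ∀ f, J f ∈ hammingCube μ ↔ ∀ i, f i = 0 ∨ f i = 1 := fun f => by
    change (∀ᵐ i ∂μ, J f i = 0 ∨ J f i = 1) ↔ _
    simp only [hJ]
    exact ⟨forall_of_ae_of_singleton_pos hpos, Filter.Eventually.of_forall⟩
  ext y
  obtain ⟨x, rfl⟩ := T.surjective y
  rw [T.injective.mem_set_image, hS]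
  have hsub : T x - J (fun i => (s i)⁻¹ * m i) = J (fun i => (s i)⁻¹ * (G x i - m i)) := by
    rw [hT, ← map_sub]
    congr 1
    ext i
    rw [Pi.sub_apply, hK, mul_sub]
  have himg : T x ∈ (fun v => J (fun i => (s i)⁻¹ * m i) + (1 : ℝ) • v) '' hammingCube μ ↔
      T x - J (fun i => (s i)⁻¹ * m i) ∈ hammingCube μ := by
    constructor
    · rintro ⟨v, hv, h⟩
      rw [← h]
      simpa using hv
    · exact fun h => ⟨_, h, by simp⟩
  rw [himg, hsub, hcube]
  refine forall_congr' fun i => ?_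
  have := (hs i).ne'
  rw [mul_eq_zero, inv_mul_eq_one₀ this, sub_eq_zero, eq_sub_iff_add_eq, or_iff_right
    (inv_ne_zero this) (b := G x i = m i)]
  rw [add_comm, eq_comm (b := G x i)]

end Norm

theorem mainTheorem2 {X : Type*} [NormedAddCommGroup X] [NormedSpace ℝ X]
    [FiniteDimensional ℝ X] (d : ℕ) (hd : Module.finrank ℝ X = d) (A : Finset X) :
    ((A : Set X) ∩ FT A).ncard ≤ 2 ^ d ∧
    (((A : Set X) ∩ FT A).ncard = 2 ^ d →
      -- `X` is a `d`-dimensional `L_1` space, the points forming a homothet of the Hamming cube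
      (∃ μ : Measure (Fin d), IsFiniteMeasure μ ∧ (∀ i, 0 < μ {i}) ∧
        ∃ T : X ≃ₗᵢ[ℝ] Lp ℝ 1 μ,
          IsHomothet (T '' ((A : Set X) ∩ FT A)) (hammingCube μ)) ∧
      -- in standard `ℓ_1^d` coordinates the points are the vertices of an axis-parallel box
      (∃ T : X ≃ₗᵢ[ℝ] PiLp 1 (fun _ : Fin d => ℝ),
        ∃ (c s : Fin d → ℝ), (∀ i, 0 < s i) ∧
          T '' ((A : Set X) ∩ FT A) =
            {y | ∀ i, y i = c i ∨ y i = c i + s i})) := by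
  classical
  obtain ⟨φ, hle, hφ⟩ := exists_norming_functionals_FT A
  obtain ⟨B, hB⟩ : ∃ B : Finset X, (B : Set X) = (A : Set X) ∩ FT A :=
    ⟨_, (A.finite_toSet.inter_of_left (FT A)).coe_toFinset⟩
  have hBmem : ∀ x, x ∈ B ↔ x ∈ A ∧ x ∈ FT A := fun x => by
    rw [← Finset.mem_coe, hB]; exact Iff.rfl
  have hφB : ∀ p ∈ B, ∀ a ∈ B, φ a (p - a) = ‖p - a‖ := fun p hp a ha =>
    hφ p ((hBmem p).1 hp).2 a ((hBmem a).1 ha).1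
  have hanti := isAntipodal_of_norming φ hφB
  rw [← hB, Set.ncard_coe_finset]
  refine ⟨hd ▸ hanti.card_le, fun hcard => ?_⟩
  obtain ⟨G, m, s, hs, hbox⟩ := hanti.exists_linearEquiv_box hd hcard
  have hnorm := norm_eq_sum_of_norming_box φ (fun a ha => hle a ((hBmem a).1 ha).1) hφB
    G m s hs hbox
  have hw : ∀ i, 0 < ‖G.symm (Pi.single i 1)‖ := fun i => by
    rw [norm_pos_iff, ne_eq, LinearEquiv.map_eq_zero_iff, Pi.single_eq_zero_iff]
    exact one_ne_zero
  exact ⟨exists_isometry_Lp_one_hammingCube G m s _ hs hw hnorm hbox,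
    exists_isometry_piLp_one_box G m s _ hs hw hnorm hbox⟩
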